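/- Let $\mathbb H_N$ be a (real or complex) Hilbert space of finite dimension $N$, and let $\{f_i\}_{i\in I}$ be a finite family of vectors in $\mathbb H_N$ which is an equal-norm Parseval frame, that is, $\|f_i\|=\|f_j\|$ for all $i,j\in I$ and $\sum_{i\in I}|\langle x,f_i\rangle|^2=\|x\|^2$ for all $x\in\mathbb H_N$. Suppose that $|I|=rN+k$ with integers $r\ge 0$ and $0\le k<N$. Then there is a partition of $I$ into $r+1$ pairwise disjoint (possibly empty) sets $I_1,\dots,I_{r+1}$ with union $I$ such that for each $i\in\{2,\dots,r+1\}$ the family $\{f_j\}_{j\in I_i}$ is linearly independent and spans $\mathbb H_N$, and the family $\{f_j\}_{j\in I_1}$ is linearly independent. -/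

import Mathlib

/-- `f` is a frame for the inner product space `H` with lower frame bound `A` and upper frame
bound `B`: `0 < A ≤ B < ∞` and `A ‖x‖² ≤ ∑ i, |⟨x, f i⟩|² ≤ B ‖x‖²` for all `x`. -/
structure IsFrameWithBounds (𝕜 : Type*) {H ι : Type*} [RCLike 𝕜] [NormedAddCommGroup H]
    [InnerProductSpace 𝕜 H] (f : ι → H) (A B : ℝ) : Prop where
  lower_pos : 0 < A
  lower_le_upper : A ≤ B
  summable : ∀ x : H, Summable fun i => ‖inner 𝕜 x (f i)‖ ^ 2
  lower : ∀ x : H, A * ‖x‖ ^ 2 ≤ ∑' i, ‖inner 𝕜 x (f i)‖ ^ 2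
  upper : ∀ x : H, ∑' i, ‖inner 𝕜 x (f i)‖ ^ 2 ≤ B * ‖x‖ ^ 2

/-- A Parseval frame is a frame with both frame bounds equal to `1`. -/
def IsParsevalFrame (𝕜 : Type*) {H ι : Type*} [RCLike 𝕜] [NormedAddCommGroup H]
    [InnerProductSpace 𝕜 H] (f : ι → H) : Prop :=
  IsFrameWithBounds 𝕜 f 1 1

/-- All vectors of the family have the same norm. -/
def IsEqualNorm {H ι : Type*} [NormedAddCommGroup H] (f : ι → H) : Prop :=
  ∀ i j, ‖f i‖ = ‖f j‖

/-! Projecting the frame onto the span of a subfamily `J` bounds `|J|` by `rank J * |I| / N`. As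
`|I| = r * N + k`, this gives `|J| ≤ r * rank J + min k (rank J)`, the Rado condition for `r` copies
of the rank and one copy truncated at `k`. The partition theorem for monotone submodular functions
then colors `I` with independent classes, one of size at most `k`; counting forces the other `r` to
have `N` elements each, so they are bases. -/

/-- Truncating a monotone submodular set function at a constant keeps it submodular. -/
theorem min_submodular {α : Type*} [DecidableEq α] (k : ℕ) (F : Finset α → ℕ)
    (hmono : Monotone F) (hsub : ∀ S T, F (S ∪ T) + F (S ∩ T) ≤ F S + F T) (S T : Finset α) :
    min k (F (S ∪ T)) + min k (F (S ∩ T)) ≤ min k (F S) + min k (F T) := by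
  have h1 := hsub S T
  have h2 : F S ≤ F (S ∪ T) := hmono Finset.subset_union_left
  have h3 : F T ≤ F (S ∪ T) := hmono Finset.subset_union_right
  have h4 : F (S ∩ T) ≤ F S := hmono Finset.inter_subset_left
  have h5 : F (S ∩ T) ≤ F T := hmono Finset.inter_subset_right
  omega

/-- If lists of admissible colors satisfy the Rado condition for a family of monotone submodular
functions, then so do some lists having at most one color each. -/
theorem exists_subsingleton_lists {α κ : Type*} [Fintype α] [DecidableEq α] [Fintype κ]
    [DecidableEq κ] (F : κ → Finset α → ℕ) (hmono : ∀ t, Monotone (F t))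
    (hsub : ∀ t S T, F t (S ∪ T) + F t (S ∩ T) ≤ F t S + F t T)
    (hF : ∀ J : Finset α, J.card ≤ ∑ t, F t J) :
    ∃ A : α → Finset κ, (∀ i, (A i).card ≤ 1) ∧
      ∀ J : Finset α, J.card ≤ ∑ t, F t {i ∈ J | t ∈ A i} := by
  -- Take minimal lists: if `A i` held two colors, deleting either one would violate the condition,
  -- on some `J` or `K` containing `i`.
  obtain ⟨A, hA⟩ := exists_minimal_of_wellFoundedLT
    (fun A : α → Finset κ => ∀ J : Finset α, J.card ≤ ∑ t, F t {i ∈ J | t ∈ A i})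
    ⟨fun _ => Finset.univ, by simpa using hF⟩
  refine ⟨A, fun i => ?_, hA.prop⟩
  by_contra! hi
  obtain ⟨x, hx, y, hy, hxy⟩ := Finset.one_lt_card.mp hi
  have key : ∀ z ∈ A i, ∃ J : Finset α, i ∈ J ∧
      ∑ t, F t {j ∈ J | t ∈ Function.update A i ((A i).erase z) j} < J.card := by
    intro z hz
    have hlt : Function.update A i ((A i).erase z) < A := by
      exact update_lt_self_iff.mpr (Finset.erase_ssubset hz)
    have hnot := hA.not_prop_of_lt hlt
    push Not at hnot
    obtain ⟨J, hJ⟩ := hnot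
    refine ⟨J, ?_, hJ⟩
    by_contra hiJ
    refine hJ.not_ge ((hA.prop J).trans (Finset.sum_le_sum fun t _ => hmono t ?_))
    intro j hj
    have hji : j ≠ i := by
      rintro rfl
      exact hiJ (Finset.mem_filter.mp hj).1
    simpa [Function.update_of_ne hji] using hj
  obtain ⟨J, hiJ, hJ⟩ := key x hx
  obtain ⟨K, hiK, hK⟩ := key y hy
  have hU := hA.prop (J ∪ K)
  -- Since `x ≠ y`, each color of `A i` survives one of the deletions, so the union keeps `i`; only
  -- the intersection must drop it. This costs 1, while the two violations together gain 2.
  have hI := hA.prop ((J ∩ K).erase i)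
  have hcard := Finset.card_union_add_card_inter J K
  have herase := Finset.card_erase_add_one (Finset.mem_inter.mpr ⟨hiJ, hiK⟩)
  have hle : ∑ t, F t {j ∈ J ∪ K | t ∈ A j} + ∑ t, F t {j ∈ (J ∩ K).erase i | t ∈ A j} ≤
      ∑ t, F t {j ∈ J | t ∈ Function.update A i ((A i).erase x) j} +
      ∑ t, F t {j ∈ K | t ∈ Function.update A i ((A i).erase y) j} := by
    rw [← Finset.sum_add_distrib, ← Finset.sum_add_distrib]
    refine Finset.sum_le_sum fun t _ => le_trans (add_le_add (hmono t ?_) (hmono t ?_)) (hsub t _ _)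
    · intro j hj
      by_cases hji : j = i
      · subst hji
        by_cases htx : t = x
        · subst htx
          simp_all
        · simp_all
      · simpa [Function.update_of_ne hji, or_and_right] using hj
    · intro j hj
      have hji : j ≠ i := by
        rintro rfl
        simp at hj
      simp only [Finset.mem_filter, Finset.mem_erase, Finset.mem_inter] at hj
      simp [hj]
  omega

/-- Partition theorem for monotone submodular functions: under the Rado condition there is a
coloring whose color classes are no larger than their values. -/
theorem exists_coloring_card_le {α κ : Type*} [Fintype α] [DecidableEq α] [Fintype κ]
    [DecidableEq κ] (F : κ → Finset α → ℕ) (hempty : ∀ t, F t ∅ = 0) (hmono : ∀ t, Monotone (F t))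
    (hsub : ∀ t S T, F t (S ∪ T) + F t (S ∩ T) ≤ F t S + F t T)
    (hF : ∀ J : Finset α, J.card ≤ ∑ t, F t J) :
    ∃ c : α → κ, ∀ t, Finset.card {i | c i = t} ≤ F t {i | c i = t} := by
  obtain ⟨A, hA1, hA⟩ := exists_subsingleton_lists F hmono hsub hF
  have hne : ∀ i, ∃ x, A i = {x} := by
    intro i
    rw [← Finset.card_eq_one]
    refine le_antisymm (hA1 i) (Finset.card_pos.mpr ?_)
    by_contra! h
    have h1 := hA {i}
    simp [Finset.filter_singleton, h, hempty] at h1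
  choose c hc using hne
  -- On the class of color `t`, the condition retains only the term of `t`.
  refine ⟨c, fun t => (hA _).trans ?_⟩
  rw [Finset.sum_eq_single t]
  · refine hmono t fun i hi => ?_
    exact (Finset.mem_filter.mp hi).1
  · intro s _ hst
    convert hempty s
    ext i
    simp only [hc, Finset.mem_filter, Finset.mem_univ, true_and, Finset.mem_singleton,
      Finset.notMem_empty, iff_false, not_and]
    rintro rfl h
    exact hst h
  · simp

/-- The rank of a finite subfamily of a family of vectors is submodular. -/
theorem finrank_span_image_submodular {𝕜 H I : Type*} [Field 𝕜] [AddCommGroup H] [Module 𝕜 H]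
    [FiniteDimensional 𝕜 H] [DecidableEq I] (f : I → H) (S T : Finset I) :
    Module.finrank 𝕜 (Submodule.span 𝕜 (f '' (S ∪ T : Finset I))) +
      Module.finrank 𝕜 (Submodule.span 𝕜 (f '' (S ∩ T : Finset I))) ≤
    Module.finrank 𝕜 (Submodule.span 𝕜 (f '' S)) +
      Module.finrank 𝕜 (Submodule.span 𝕜 (f '' T)) := by
  rw [← Submodule.finrank_sup_add_finrank_inf_eq (Submodule.span 𝕜 (f '' S)), Finset.coe_union, Set.image_union,
    Submodule.span_union]
  refine Nat.add_le_add_left (Submodule.finrank_mono ?_) _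
  exact le_inf
    (Submodule.span_mono (Set.image_mono (Finset.coe_subset.mpr Finset.inter_subset_left)))
    (Submodule.span_mono (Set.image_mono (Finset.coe_subset.mpr Finset.inter_subset_right)))

theorem IsParsevalFrame.sum_norm_inner_sq {𝕜 H I : Type*} [RCLike 𝕜] [NormedAddCommGroup H]
    [InnerProductSpace 𝕜 H] [Fintype I] {f : I → H} (hf : IsParsevalFrame 𝕜 f) (x : H) :
    ∑ i, ‖inner 𝕜 x (f i)‖ ^ 2 = ‖x‖ ^ 2 := by
  have h1 := hf.lower x
  have h2 := hf.upper x
  rw [tsum_fintype] at h1 h2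
  linarith

/-- For a Parseval frame, the dimension of a subspace is the sum of the squared norms of the
projections of the frame vectors. -/
theorem IsParsevalFrame.finrank_eq_sum {𝕜 H I : Type*} [RCLike 𝕜] [NormedAddCommGroup H]
    [InnerProductSpace 𝕜 H] [FiniteDimensional 𝕜 H] [Fintype I] {f : I → H}
    (hf : IsParsevalFrame 𝕜 f) (W : Submodule 𝕜 H) :
    (Module.finrank 𝕜 W : ℝ) = ∑ i, ‖W.orthogonalProjectionOnto (f i)‖ ^ 2 := by
  have h : ∀ i, ‖W.orthogonalProjectionOnto (f i)‖ ^ 2 =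
      ∑ a, ‖inner 𝕜 (stdOrthonormalBasis 𝕜 W a : H) (f i)‖ ^ 2 := by
    intro i
    rw [← (stdOrthonormalBasis 𝕜 W).sum_sq_norm_inner_right]
    simp
  rw [Finset.sum_congr rfl fun i _ => h i, Finset.sum_comm,
    Finset.sum_congr rfl fun a _ => hf.sum_norm_inner_sq (stdOrthonormalBasis 𝕜 W a : H)]
  simp [← Submodule.coe_norm, OrthonormalBasis.norm_eq_one]

/-- Projection onto the span of `J` fixes each vector of `J`, so with common norm `a` its rank is at
least `|J| * a ^ 2`; the whole space gives `N = |I| * a ^ 2`. -/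
theorem IsParsevalFrame.card_mul_finrank_le {𝕜 H I : Type*} [RCLike 𝕜] [NormedAddCommGroup H]
    [InnerProductSpace 𝕜 H] [FiniteDimensional 𝕜 H] [Fintype I] {f : I → H}
    (hf : IsParsevalFrame 𝕜 f) (hnorm : IsEqualNorm f) (J : Finset I) :
    J.card * Module.finrank 𝕜 H ≤
      Module.finrank 𝕜 (Submodule.span 𝕜 (f '' J)) * Fintype.card I := by
  rcases J.eq_empty_or_nonempty with rfl | ⟨i₀, -⟩
  · simp
  have hmem : ∀ (W : Submodule 𝕜 H) (i : I), f i ∈ W →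
      ‖W.orthogonalProjectionOnto (f i)‖ ^ 2 = ‖f i₀‖ ^ 2 := by
    intro W i hi
    rw [hnorm i₀ i, Submodule.norm_orthogonalProjectionOnto_apply W hi]
  have htop : (Module.finrank 𝕜 H : ℝ) = Fintype.card I * ‖f i₀‖ ^ 2 := by
    rw [← finrank_top, hf.finrank_eq_sum, Finset.sum_congr rfl fun i _ => hmem ⊤ i Submodule.mem_top]
    simp
  have hJ : J.card * ‖f i₀‖ ^ 2 ≤ (Module.finrank 𝕜 (Submodule.span 𝕜 (f '' J)) : ℝ) := by
    rw [hf.finrank_eq_sum, ← nsmul_eq_mul, ← Finset.sum_const]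
    rw [← Finset.sum_congr rfl fun i hi =>
      hmem (Submodule.span 𝕜 (f '' J)) i (Submodule.subset_span ⟨i, hi, rfl⟩)]
    exact Finset.sum_le_sum_of_subset_of_nonneg (Finset.subset_univ _) fun _ _ _ => by positivity
  have := mul_le_mul_of_nonneg_right hJ (Nat.cast_nonneg (Fintype.card I))
  rw [← @Nat.cast_le ℝ]
  push_cast
  rw [htop]
  linarith

theorem mainTheorem3 {𝕜 H I : Type*} [RCLike 𝕜] [NormedAddCommGroup H] [InnerProductSpace 𝕜 H]
    [FiniteDimensional 𝕜 H] [Fintype I] (N r k : ℕ) (hN : Module.finrank 𝕜 H = N) (hk : k < N)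
    (hcard : Fintype.card I = r * N + k) (f : I → H)
    (hparseval : IsParsevalFrame 𝕜 f) (hnorm : IsEqualNorm f) :
    ∃ P : Fin (r + 1) → Set I,
      (∀ i j, i ≠ j → Disjoint (P i) (P j)) ∧ (⋃ i, P i) = Set.univ ∧
      (∀ i, i ≠ 0 →
        LinearIndependent 𝕜 (fun j : P i => f j) ∧ Submodule.span 𝕜 (f '' P i) = ⊤) ∧
      LinearIndependent 𝕜 (fun j : P 0 => f j) := by
  classical
  let rk : Finset I → ℕ := fun J => Module.finrank 𝕜 (Submodule.span 𝕜 (f '' J))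
  have rk_empty : rk ∅ = 0 := by simp [rk]
  have rk_mono : Monotone rk := fun S T hST =>
    Submodule.finrank_mono (Submodule.span_mono (Set.image_mono (Finset.coe_subset.mpr hST)))
  have rk_sub : ∀ S T, rk (S ∪ T) + rk (S ∩ T) ≤ rk S + rk T :=
    finrank_span_image_submodular f
  have rk_le : ∀ J, rk J ≤ N := fun J => hN ▸ Submodule.finrank_le _
  let F : Fin (r + 1) → Finset I → ℕ := Fin.cons (fun J => min k (rk J)) fun _ => rk
  have hF : ∀ J : Finset I, J.card ≤ ∑ t, F t J := by
    intro J
    have h := hparseval.card_mul_finrank_le hnorm J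
    change J.card * _ ≤ rk J * _ at h
    rw [hN, hcard] at h
    have hJ := rk_le J
    simp only [Fin.sum_univ_succ, F, Fin.cons_zero, Fin.cons_succ, Finset.sum_const,
      Finset.card_univ, Fintype.card_fin, smul_eq_mul]
    refine Nat.le_of_mul_le_mul_right (h.trans ?_) (by omega : 0 < N)
    -- Both cases reduce to `rk J * k ≤ min k (rk J) * N`, by `rk J ≤ N` or by `k < N`.
    rcases le_total k (rk J) with hle | hle
    · rw [min_eq_left hle]
      nlinarith
    · rw [min_eq_right hle]
      nlinarith
  obtain ⟨c, hc⟩ := exists_coloring_card_le F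
    (fun t => by cases t using Fin.cases <;> simp [F, rk_empty])
    (fun t => by
      cases t using Fin.cases with
      | zero => exact fun S T h => min_le_min_left k (rk_mono h)
      | succ t => exact rk_mono)
    (fun t => by
      cases t using Fin.cases with
      | zero => exact min_submodular k rk rk_mono rk_sub
      | succ t => exact rk_sub) hF
  have hc_rk : ∀ t, Finset.card {i | c i = t} ≤ rk {i | c i = t} := by
    intro t
    refine (hc t).trans ?_
    cases t using Fin.cases with
    | zero => exact min_le_right _ _
    | succ t => exact le_rfl
  have hc_zero : Finset.card {i | c i = 0} ≤ k := (hc 0).trans (min_le_left _ _)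
  have hrk : ∀ t, rk {i | c i = t} = Module.finrank 𝕜 (Submodule.span 𝕜 (f '' {i | c i = t})) := by
    intro t
    change Module.finrank 𝕜 (Submodule.span 𝕜 (f '' (Finset.filter _ _ : Finset I))) = _
    rw [Finset.coe_filter_univ]
  have hli : ∀ t, LinearIndependent 𝕜 (fun j : {i | c i = t} => f j) := by
    intro t
    rw [linearIndependent_iff_card_le_finrank_span]
    rw [Set.finrank, ← Set.image_eq_range, ← Set.toFinset_card, Set.toFinset_ofPred]
    exact (hc_rk t).trans_eq (hrk t)
  have hfull : ∀ t : Fin r, N ≤ Finset.card {i | c i = t.succ} := by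
    have hsum : ∑ t, Finset.card {i | c i = t} = Fintype.card I :=
      (Finset.card_eq_sum_card_fiberwise fun _ _ => Finset.mem_univ _).symm
    rw [Fin.sum_univ_succ, hcard] at hsum
    by_contra! h
    obtain ⟨t, ht⟩ := h
    have hlt : ∑ t : Fin r, Finset.card {i | c i = t.succ} < ∑ _t : Fin r, N :=
      Finset.sum_lt_sum (fun s _ => (hc_rk _).trans (rk_le _)) ⟨t, Finset.mem_univ t, ht⟩
    simp only [Finset.sum_const, Finset.card_univ, Fintype.card_fin, smul_eq_mul] at hlt
    omega
  refine ⟨fun t => {i | c i = t}, fun s t hst => ?_, ?_, fun t ht => ⟨hli t, ?_⟩, hli 0⟩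
  · rw [Set.disjoint_left]
    rintro i rfl h
    exact hst h
  · ext i
    simp
  · obtain ⟨t, rfl⟩ := Fin.exists_succ_eq.mpr ht
    apply Submodule.eq_top_of_finrank_eq
    refine le_antisymm (Submodule.finrank_le _) ?_
    exact hN.trans_le (((hfull t).trans (hc_rk t.succ)).trans_eq (hrk t.succ))
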